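/- Let $G=(\mathcal V,\mathcal E)$ be a finite graph, and let $J_e\ge 0$ $(e\in\mathcal E)$ and $\lambda_v\ge 0$ $(v\in\mathcal V)$ be real numbers. For $J_e>0$ put $$V_e(\theta)=\sum_{m\in\mathbb Z}\exp\Big(-\frac{J_e}{2}(\theta+2\pi m)^2\Big),$$ and for $J_e=0$ (where this series diverges) put $V_e\equiv 1$, i.e. the edge $e$ carries no interaction. Let $(\Theta_v)_{v\in\mathcal V}$ be distributed according to the Villain model on $G$ with free boundary conditions, that is, according to the probability measure $$Z_G^{-1}\prod_{e=\{u,v\}\in\mathcal E}V_e(\theta_u-\theta_v)\prod_{v\in\mathcal V}d\theta_v,\qquad \theta_v\in(-\pi,\pi],$$ where $d\theta_v$ is Lebesgue measure on $(-\pi,\pi]$ and $Z_G$ is the normalizing constant, and let $\mu_\lambda$ be the distribution of $\sum_{v}\lambda_v\cos\Theta_v$. Then this is a well-defined probability measure, the function $$f_V(z)=\mathbb E\Big[\exp\Big(z\sum_{v\in\mathcal V}\lambda_v\cos\Theta_v\Big)\Big]=\int_{-\infty}^{\infty}e^{zx}\,d\mu_\lambda(x)$$ is well defined for every $z\in\mathbb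 C$ (the integrands are integrable), and all zeros of $f_V$ are purely imaginary: if $f_V(z)=0$ then $\operatorname{Re} z=0$. -/

import Mathlib

open MeasureTheory

namespace Villain

/-- The edge weight of the Villain model, the periodized Gaussian
`V_J(θ) = ∑_{m ∈ ℤ} exp (-(J/2) (θ + 2πm)²)` for `J > 0`. At `J = 0` this series diverges; since
`V_J(θ) / V_J(0) → 1` as `J ↓ 0` and constant factors cancel in the normalized measure,
a zero coupling means no interaction, i.e. the constant weight `1`. -/
noncomputable def edgeWeight (J θ : ℝ) : ℝ :=
  if J = 0 then 1 else ∑' m : ℤ, Real.exp (-(J / 2) * (θ + 2 * Real.pi * m) ^ 2)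

theorem edgeWeight_neg (J θ : ℝ) : edgeWeight J (-θ) = edgeWeight J θ := by
  unfold edgeWeight
  split_ifs
  · rfl
  · rw [← (Equiv.neg ℤ).tsum_eq]
    refine tsum_congr fun m => ?_
    congr 2
    simp only [Equiv.neg_apply]
    push_cast
    ring

variable {V : Type*}

/-- The weight `V_e(θ_u - θ_v)` attached to an unordered pair `e = {u, v}` with coupling `J`. -/
noncomputable def pairWeight (J : ℝ) (θ : V → ℝ) (e : Sym2 V) : ℝ :=
  Sym2.lift ⟨fun u v => edgeWeight J (θ u - θ v), fun u v => by
    show edgeWeight J (θ u - θ v) = edgeWeight J (θ v - θ u)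
    rw [← edgeWeight_neg, neg_sub]⟩ e

/-- The unnormalized density `∏_{e = {u,v}} V_e(θ_u - θ_v)`. -/
noncomputable def density (G : SimpleGraph V) [Fintype G.edgeSet] (J : G.edgeSet → ℝ)
    (θ : V → ℝ) : ℝ :=
  ∏ e : G.edgeSet, pairWeight (J e) θ e.1

/-- The unnormalized measure `∏_e V_e(θ_u - θ_v) ∏_v dθ_v` on `(-π, π]^V`. -/
noncomputable def unnormalizedMeasure [Fintype V] (G : SimpleGraph V) [Fintype G.edgeSet]
    (J : G.edgeSet → ℝ) : Measure (V → ℝ) :=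
  (Measure.pi fun _ : V => (volume : Measure ℝ).restrict (Set.Ioc (-Real.pi) Real.pi)).withDensity
    fun θ => ENNReal.ofReal (density G J θ)

/-- The Gibbs measure of the Villain model on `G` with free boundary conditions. -/
noncomputable def gibbsMeasure [Fintype V] (G : SimpleGraph V) [Fintype G.edgeSet]
    (J : G.edgeSet → ℝ) : Measure (V → ℝ) :=
  (unnormalizedMeasure G J Set.univ)⁻¹ • unnormalizedMeasure G J

/-- The random variable `∑_v λ_v cos θ_v`. -/
noncomputable def magnetization [Fintype V] (lam : V → ℝ) (θ : V → ℝ) : ℝ :=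
  ∑ v, lam v * Real.cos (θ v)

/-- The distribution `μ_λ` of `∑_v λ_v cos Θ_v`, where `Θ` has the Villain law. -/
noncomputable def magnetizationLaw [Fintype V] (G : SimpleGraph V) [Fintype G.edgeSet]
    (J : G.edgeSet → ℝ) (lam : V → ℝ) : Measure ℝ :=
  (gibbsMeasure G J).map (magnetization lam)

end Villain

/-!
By Poisson summation each edge weight is a constant times a Jacobi theta function, and the triple
product identity writes the latter as the limit of the products of the factors
`(1 + q ^ (2j+1) s_u / s_v) (1 + q ^ (2j+1) s_v / s_u)`, where `s_v = exp (i θ_v)`. Likewise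
`exp (z λ_v cos θ_v)` is the limit of `(1 + c z s_v) ^ n (1 + c z / s_v) ^ n` with `c = λ_v / (2n)`.
For `Re z > 0` none of these factors vanishes when all `s_v` lie in the open right half plane, so
up to constants the moment generating function is a limit of constant terms of Laurent polynomials
with stable numerators.

Extracting a coefficient is a limit as `t ↓ 0` of operators `t + ∂_v`, which preserve stability by
the Gauss-Lucas argument. Hence, by Hurwitz's theorem, the moment generating function has no zeros
with `Re z > 0`, since it does not vanish at `z = 1`. Rotating all angles by `π` shows that it is
even, which excludes zeros with `Re z < 0`.
-/

namespace Villain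

open Filter Topology

section Hurwitz

theorem tendstoLocallyUniformlyOn_of_tendsto_prod {ι X Y : Type*} [TopologicalSpace X]
    [PseudoMetricSpace Y] {l : Filter ι} [l.NeBot] {U : Set X} {F : ι → X → Y} {f : X → Y}
    (hU : IsOpen U)
    (hF : ∀ x ∈ U, Tendsto (fun p : ι × X => F p.1 p.2) (l ×ˢ 𝓝 x) (𝓝 (f x))) :
    TendstoLocallyUniformlyOn F f l U := by
  refine Metric.tendstoLocallyUniformlyOn_iff.2 fun ε hε x hx => ?_
  obtain ⟨p, hp, q, hq, hpq⟩ :=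
    eventually_prod_iff.1 (Metric.tendsto_nhds.1 (hF x hx) (ε / 2) (half_pos hε))
  have hlim (y : X) (hyU : y ∈ U) (hy : q y) : dist (f y) (f x) ≤ ε / 2 := by
    have hFy : Tendsto (fun i => F i y) l (𝓝 (f y)) :=
      (hF y hyU).comp (tendsto_id.prodMk (tendsto_const_nhds (x := y)))
    refine le_of_tendsto (hFy.dist tendsto_const_nhds) ?_
    filter_upwards [hp] with i hi using (hpq hi hy).le
  refine ⟨{y | y ∈ U ∧ q y},
    mem_nhdsWithin_of_mem_nhds (inter_mem (hU.mem_nhds hx) hq), ?_⟩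
  filter_upwards [hp] with i hi y hy
  calc dist (f y) (F i y) ≤ dist (f y) (f x) + dist (F i y) (f x) := dist_triangle_right _ _ _
    _ < ε / 2 + ε / 2 := add_lt_add_of_le_of_lt (hlim y hy.1 hy.2) (hpq hi hy.2)
    _ = ε := add_halves ε

theorem le_norm_center_of_forall_mem_sphere {g : ℂ → ℂ} {c : ℂ} {r δ : ℝ} (hr : 0 < r)
    (hδ : 0 < δ) (hg : DifferentiableOn ℂ g (Metric.closedBall c r))
    (hg0 : ∀ z ∈ Metric.closedBall c r, g z ≠ 0) (hle : ∀ z ∈ Metric.sphere c r, δ ≤ ‖g z‖) :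
    δ ≤ ‖g c‖ := by
  have hinv : DiffContOnCl ℂ (fun z => (g z)⁻¹) (Metric.ball c r) := by
    apply DifferentiableOn.diffContOnCl
    rw [closure_ball c hr.ne']
    exact hg.inv hg0
  have hcenter : ‖(g c)⁻¹‖ ≤ δ⁻¹ := by
    refine Complex.norm_le_of_forall_mem_frontier_norm_le Metric.isBounded_ball hinv
      (fun z hz => ?_) (subset_closure (Metric.mem_ball_self hr))
    rw [frontier_ball c hr.ne'] at hz
    exact norm_inv (g z) ▸ inv_anti₀ hδ (hle z hz)
  rw [norm_inv] at hcenter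
  exact (inv_le_inv₀ (norm_pos_iff.2 (hg0 c (Metric.mem_closedBall_self hr.le))) hδ).1 hcenter

/-- The dichotomy in Hurwitz's theorem: it passes to locally uniform limits of holomorphic functions
on a connected domain, whereas zero-freeness alone does not. -/
def ZeroFreeOrZero (f : ℂ → ℂ) (U : Set ℂ) : Prop :=
  (∀ z ∈ U, f z ≠ 0) ∨ ∀ z ∈ U, f z = 0

theorem exists_closedBall_subset_forall_ne_zero {f : ℂ → ℂ} {U : Set ℂ} {c : ℂ} (hU : IsOpen U)
    (hc : c ∈ U) (hf : ∀ᶠ z in 𝓝[≠] c, f z ≠ 0) :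
    ∃ r > 0, Metric.closedBall c r ⊆ U ∧ ∀ z ∈ Metric.sphere c r, f z ≠ 0 := by
  have hnear : ∀ᶠ z in 𝓝 c, z ∈ U ∧ (z ≠ c → f z ≠ 0) :=
    (hU.eventually_mem hc).and (eventually_nhdsWithin_iff.1 hf)
  obtain ⟨r, hr, hball⟩ := Metric.nhds_basis_closedBall.eventually_iff.1 hnear
  refine ⟨r, hr, fun z hz => (hball hz).1, fun z hz => ?_⟩
  exact (hball (Metric.sphere_subset_closedBall hz)).2 (Metric.ne_of_mem_sphere hz hr.ne')

theorem ne_zero_of_tendstoLocallyUniformlyOn {ι : Type*} {l : Filter ι} [l.NeBot] {U : Set ℂ}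
    {F : ι → ℂ → ℂ} {f : ℂ → ℂ} {c : ℂ} (hU : IsOpen U)
    (hlim : TendstoLocallyUniformlyOn F f l U) (hF : ∀ᶠ i in l, DifferentiableOn ℂ (F i) U)
    (hF0 : ∀ᶠ i in l, ∀ z ∈ U, F i z ≠ 0) (hc : c ∈ U) (hf0 : ∀ᶠ z in 𝓝[≠] c, f z ≠ 0) :
    f c ≠ 0 := by
  obtain ⟨r, hr, hrU, hsphere⟩ := exists_closedBall_subset_forall_ne_zero hU hc hf0
  have hf : ContinuousOn f (Metric.sphere c r) :=
    (hlim.differentiableOn hF hU).continuousOn.mono (Metric.sphere_subset_closedBall.trans hrU)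
  obtain ⟨w, hw, hmin⟩ := (isCompact_sphere c r).exists_isMinOn
    (NormedSpace.sphere_nonempty.2 hr.le) hf.norm
  have hfw : 0 < ‖f w‖ := norm_pos_iff.2 (hsphere w hw)
  have hunif : TendstoUniformlyOn F f l (Metric.sphere c r) :=
    (tendstoLocallyUniformlyOn_iff_tendstoUniformlyOn_of_compact (isCompact_sphere c r)).1
      (hlim.mono (Metric.sphere_subset_closedBall.trans hrU))
  have hcenter : ∀ᶠ i in l, ‖f w‖ / 2 ≤ ‖F i c‖ := by
    filter_upwards [Metric.tendstoUniformlyOn_iff.1 hunif _ (half_pos hfw), hF, hF0]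
      with i hclose hdiff hne
    refine le_norm_center_of_forall_mem_sphere hr (half_pos hfw) (hdiff.mono hrU)
      (fun z hz => hne z (hrU hz)) fun z hz => ?_
    have hfz : ‖f w‖ ≤ ‖f z‖ := hmin hz
    have hFz : ‖f z‖ - ‖F i z‖ ≤ dist (f z) (F i z) := dist_eq_norm (f z) _ ▸ norm_sub_norm_le _ _
    linarith [hclose z hz]
  exact norm_pos_iff.1 ((half_pos hfw).trans_le (ge_of_tendsto (hlim.tendsto_at hc).norm hcenter))

theorem ZeroFreeOrZero.of_tendstoLocallyUniformlyOn {ι : Type*} {l : Filter ι} [l.NeBot]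
    {U : Set ℂ} {F : ι → ℂ → ℂ} {f : ℂ → ℂ} (hU : IsOpen U) (hU' : IsPreconnected U)
    (hlim : TendstoLocallyUniformlyOn F f l U) (hF : ∀ᶠ i in l, DifferentiableOn ℂ (F i) U)
    (hF0 : ∀ᶠ i in l, ZeroFreeOrZero (F i) U) : ZeroFreeOrZero f U := by
  by_cases hzero : ∃ᶠ i in l, ∀ z ∈ U, F i z = 0
  · exact .inr fun z hz => isClosed_singleton.mem_of_frequently_of_tendsto
      (hzero.mono fun i hi => hi z hz) (hlim.tendsto_at hz)
  have hfree : ∀ᶠ i in l, ∀ z ∈ U, F i z ≠ 0 := by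
    filter_upwards [hF0, not_frequently.1 hzero] with i hi hi' using hi.resolve_right hi'
  have hf : AnalyticOnNhd ℂ f U := (hlim.differentiableOn hF hU).analyticOnNhd hU
  refine or_iff_not_imp_right.2 fun hne c hc => ?_
  refine ne_zero_of_tendstoLocallyUniformlyOn hU hlim hF hfree hc ?_
  by_contra hfreq
  exact hne (hf.eqOn_zero_of_preconnected_of_frequently_eq_zero hU' hc
    ((not_eventually.1 hfreq).mono fun z hz => not_not.1 hz))

/-- The domain `Re z > 0` on which the moment generating function is shown to have no zeros. -/
abbrev rightHalfPlane : Set ℂ := {z | 0 < z.re}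

theorem isOpen_rightHalfPlane : IsOpen rightHalfPlane :=
  isOpen_lt continuous_const Complex.continuous_re

theorem isPreconnected_rightHalfPlane : IsPreconnected rightHalfPlane :=
  (convex_halfSpace_re_gt 0).isPreconnected

end Hurwitz

section Stability

open MvPolynomial

variable {V R : Type*} [CommSemiring R]

/-- Stability with respect to the right half plane: a polynomial without zeros in the product of
the open half planes `Re s_v > 0`. -/
def Stable (P : MvPolynomial V ℂ) : Prop :=
  ∀ s : V → ℂ, (∀ v, 0 < (s v).re) → eval s P ≠ 0

theorem Stable.mul {P Q : MvPolynomial V ℂ} (hP : Stable P) (hQ : Stable Q) : Stable (P * Q) := by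
  intro s hs
  rw [map_mul]
  exact mul_ne_zero (hP s hs) (hQ s hs)

/-- The univariate polynomial obtained from `P` by freezing every variable except `v`. -/
noncomputable def slice [DecidableEq V] (s : V → R) (v : V) (P : MvPolynomial V R) :
    Polynomial R :=
  aeval (Function.update (fun u => Polynomial.C (s u)) v Polynomial.X) P

theorem eval_slice [DecidableEq V] (s : V → R) (v : V) (x : R) (P : MvPolynomial V R) :
    (slice s v P).eval x = eval (Function.update s v x) P := by
  rw [slice, ← Polynomial.coe_evalRingHom, aeval_def, hom_eval₂, eval, coe_eval₂Hom]
  congr 1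
  · ext a
    simp
  · funext u
    rcases eq_or_ne u v with rfl | huv
    · simp
    · simp [huv]

theorem derivative_slice [DecidableEq V] (s : V → R) (v : V) (P : MvPolynomial V R) :
    Polynomial.derivative (slice s v P) = slice s v (pderiv v P) := by
  induction P using MvPolynomial.induction_on with
  | C a => simp [slice]
  | add p q hp hq => simp_all [slice]
  | mul_X p u hp =>
    have hX : Polynomial.derivative (slice s v (X u)) = slice s v (pderiv v (X u)) := by
      rcases eq_or_ne u v with rfl | huv
      · simp [slice]
      · simp [slice, pderiv_X_of_ne huv, huv]
    simp only [slice, map_mul, map_add, Polynomial.derivative_mul, pderiv_mul] at hp hX ⊢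
    rw [hp, hX]

theorem re_eval_derivative_div_eval_nonneg {q : Polynomial ℂ}
    (hq : ∀ x : ℂ, 0 < x.re → q.eval x ≠ 0) {x : ℂ} (hx : 0 < x.re) :
    0 ≤ (q.derivative.eval x / q.eval x).re := by
  rw [(IsAlgClosed.splits q).eval_derivative_div_eval_of_ne_zero (hq x hx),
    ← Complex.coe_reAddGroupHom, map_multiset_sum, Multiset.map_map]
  refine Multiset.sum_nonneg (Multiset.forall_mem_map_iff.2 fun z hz => ?_)
  have hzre : z.re ≤ 0 := not_lt.1 fun h => hq z h (Polynomial.isRoot_of_mem_roots hz)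
  simp only [Function.comp_apply, Complex.coe_reAddGroupHom, one_div, Complex.inv_re,
    Complex.sub_re]
  exact div_nonneg (by linarith) (Complex.normSq_nonneg _)

theorem Stable.add_pderiv {P : MvPolynomial V ℂ} (hP : Stable P) {t : ℝ} (ht : 0 < t) (v : V) :
    Stable (C (t : ℂ) * P + pderiv v P) := by
  classical
  intro s hs
  have hslice (x : ℂ) (hx : 0 < x.re) : (slice s v P).eval x ≠ 0 := by
    rw [eval_slice]
    refine hP _ fun u => ?_
    rcases eq_or_ne u v with rfl | huv
    · simpa using hx
    · simpa [huv] using hs u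
  have hre := re_eval_derivative_div_eval_nonneg hslice (hs v)
  rw [derivative_slice, eval_slice, eval_slice, Function.update_eq_self] at hre
  rw [map_add, map_mul, eval_C]
  intro h
  have hdiv : eval s (pderiv v P) / eval s P = -t := by
    rw [div_eq_iff (hP s hs)]
    linear_combination h
  rw [hdiv, Complex.neg_re, Complex.ofReal_re] at hre
  linarith

/-- The composition of the operators `t + ∂_v` over the entries `v` of a list. For `t > 0` it
preserves stability, and at `t = 0` it extracts a coefficient. -/
noncomputable def shiftDeriv (t : R) (l : List V) (P : MvPolynomial V R) : MvPolynomial V R :=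
  l.foldr (fun v Q => C t * Q + pderiv v Q) P

theorem shiftDeriv_cons (t : R) (v : V) (l : List V) (P : MvPolynomial V R) :
    shiftDeriv t (v :: l) P = C t * shiftDeriv t l P + pderiv v (shiftDeriv t l P) := rfl

theorem map_shiftDeriv {S : Type*} [CommSemiring S] (f : R →+* S) (t : R) (l : List V)
    (P : MvPolynomial V R) : map f (shiftDeriv t l P) = shiftDeriv (f t) l (map f P) := by
  induction l with
  | nil => rfl
  | cons v l ih => rw [shiftDeriv_cons, shiftDeriv_cons, map_add, map_mul, map_C, ← pderiv_map, ih]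

theorem Stable.shiftDeriv {P : MvPolynomial V ℂ} (hP : Stable P) {t : ℝ} (ht : 0 < t)
    (l : List V) : Stable (shiftDeriv (t : ℂ) l P) := by
  induction l with
  | nil => exact hP
  | cons v l ih => exact ih.add_pderiv ht v

theorem exists_coeff_shiftDeriv_zero [DecidableEq V] (l : List V) (m : V →₀ ℕ) :
    ∃ c : ℕ, c ≠ 0 ∧ ∀ P : MvPolynomial V R,
      coeff m (shiftDeriv 0 l P) = c * coeff (m + Multiset.toFinsupp (l : Multiset V)) P := by
  induction l generalizing m with
  | nil => exact ⟨1, one_ne_zero, fun P => by simp [shiftDeriv]⟩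
  | cons v l ih =>
    obtain ⟨c, hc, hcoeff⟩ := ih (m + Finsupp.single v 1)
    refine ⟨(m v + 1) * c, mul_ne_zero (m v).succ_ne_zero hc, fun P => ?_⟩
    rw [shiftDeriv_cons, map_zero, zero_mul, zero_add, coeff_pderiv, hcoeff, ← Multiset.cons_coe,
      ← Multiset.singleton_add, map_add, Multiset.toFinsupp_singleton, add_assoc]
    push_cast
    ring

theorem exists_evalEval_eq_eval_shiftDeriv (l : List V) (P : MvPolynomial V (Polynomial R)) :
    ∃ Q : Polynomial (Polynomial R), ∀ z t : R, Q.evalEval z t =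
      eval (fun _ => t) (shiftDeriv t l (map (Polynomial.evalRingHom z) P)) := by
  refine ⟨eval (fun _ => Polynomial.X) (shiftDeriv Polynomial.X l (map Polynomial.C P)),
    fun z t => ?_⟩
  have hcomp : (Polynomial.evalEvalRingHom z t).comp Polynomial.C = Polynomial.evalRingHom z := by
    ext <;> simp
  rw [← Polynomial.coe_evalEvalRingHom, MvPolynomial.map_eval, map_shiftDeriv,
    MvPolynomial.map_map, hcomp]
  simp [Function.comp_def]

theorem continuous_evalEval [TopologicalSpace R] [IsTopologicalSemiring R]
    (Q : Polynomial (Polynomial R)) : Continuous fun p : R × R => Q.evalEval p.2 p.1 := by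
  simp only [Polynomial.evalEval, Polynomial.eval_eq_sum_range (p := Q),
    Polynomial.eval_finsetSum, Polynomial.eval_mul, Polynomial.eval_pow, Polynomial.eval_C]
  fun_prop

theorem zeroFreeOrZero_eval_coeff {P : MvPolynomial V (Polynomial ℂ)}
    (hP : ∀ z ∈ rightHalfPlane, Stable (map (Polynomial.evalRingHom z) P)) (m : V →₀ ℕ) :
    ZeroFreeOrZero (fun z => (coeff m P).eval z) rightHalfPlane := by
  classical
  obtain ⟨c, hc, hcoeff⟩ := exists_coeff_shiftDeriv_zero (R := ℂ) m.toMultiset.toList 0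
  have hzero (z : ℂ) : eval (fun _ => (0 : ℂ)) (shiftDeriv 0 m.toMultiset.toList
      (map (Polynomial.evalRingHom z) P)) = c * (coeff m P).eval z := by
    have h := hcoeff (map (Polynomial.evalRingHom z) P)
    rw [Multiset.coe_toList, Finsupp.toMultiset_toFinsupp, zero_add, coeff_map] at h
    rw [← Polynomial.coe_evalRingHom, ← h, ← constantCoeff_eq]
    exact DFunLike.congr_fun eval_zero' _
  obtain ⟨Q, hQ⟩ := exists_evalEval_eq_eval_shiftDeriv m.toMultiset.toList P
  have hlim : TendstoLocallyUniformlyOn (fun (t : ℝ) (z : ℂ) => Q.evalEval z t)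
      (fun z => c * (coeff m P).eval z) (𝓝[>] 0) rightHalfPlane := by
    refine tendstoLocallyUniformlyOn_of_tendsto_prod isOpen_rightHalfPlane fun z _ => ?_
    have hcont : Continuous fun p : ℝ × ℂ => Q.evalEval p.2 p.1 :=
      (continuous_evalEval Q).comp (Complex.continuous_ofReal.prodMap continuous_id)
    have h := hcont.tendsto (0, z)
    rw [Complex.ofReal_zero, hQ, hzero, nhds_prod_eq] at h
    exact h.mono_left (prod_mono nhdsWithin_le_nhds le_rfl)
  have hstable (t : ℝ) (ht : 0 < t) : ZeroFreeOrZero (fun z => Q.evalEval z t) rightHalfPlane :=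
    .inl fun z hz => (hQ z t).trans_ne ((hP z hz).shiftDeriv ht _ _ fun _ => by simpa using ht)
  have hdichotomy := ZeroFreeOrZero.of_tendstoLocallyUniformlyOn isOpen_rightHalfPlane
    isPreconnected_rightHalfPlane hlim
    (.of_forall fun t => (Polynomial.differentiable _).differentiableOn)
    (eventually_nhdsWithin_of_forall hstable)
  have hc' : (c : ℂ) ≠ 0 := Nat.cast_ne_zero.2 hc
  simpa [ZeroFreeOrZero, hc'] using hdichotomy

end Stability

section ConstantTerm

open MvPolynomial

variable {V : Type*}

/-- The point of the unit torus with angles `θ`. -/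
noncomputable def torusPoint (θ : V → ℝ) (v : V) : ℂ :=
  Complex.exp (θ v * Complex.I)

theorem torusPoint_ne_zero (θ : V → ℝ) (v : V) : torusPoint θ v ≠ 0 := Complex.exp_ne_zero _

theorem norm_torusPoint (θ : V → ℝ) (v : V) : ‖torusPoint θ v‖ = 1 :=
  Complex.norm_exp_ofReal_mul_I _

theorem continuous_torusPoint : Continuous (torusPoint (V := V)) := by
  unfold torusPoint
  fun_prop

theorem integral_exp_mul_I_zpow (n : ℤ) (α : ℝ) :
    ∫ θ in Set.Ioc (-Real.pi) Real.pi, Complex.exp ((θ + α : ℝ) * Complex.I) ^ n =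
      if n = 0 then 2 * (Real.pi : ℂ) else 0 := by
  rw [← intervalIntegral.integral_of_le (by linarith [Real.pi_pos])]
  split_ifs with hn
  · simp [hn, ← two_mul]
  · have hc : n * Complex.I ≠ 0 := mul_ne_zero (Int.cast_ne_zero.2 hn) Complex.I_ne_zero
    have hshift (θ : ℝ) : Complex.exp ((θ + α : ℝ) * Complex.I) ^ n =
        Complex.exp (n * Complex.I * α) * Complex.exp (n * Complex.I * θ) := by
      rw [← Complex.exp_int_mul, ← Complex.exp_add]
      push_cast
      ring_nf
    have hperiod : Complex.exp (n * Complex.I * Real.pi) =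
        Complex.exp (n * Complex.I * (-Real.pi : ℝ)) :=
      Complex.exp_eq_exp_iff_exists_int.2 ⟨n, by push_cast; ring⟩
    simp_rw [hshift]
    rw [intervalIntegral.integral_const_mul, integral_exp_mul_complex hc, hperiod, sub_self,
      zero_div, mul_zero]

variable [Fintype V]

/-- Lebesgue measure on the box `(-π, π]^V` of angles, without normalization. -/
noncomputable abbrev torusMeasure (V : Type*) [Fintype V] : Measure (V → ℝ) :=
  Measure.pi fun _ : V => (volume : Measure ℝ).restrict (Set.Ioc (-Real.pi) Real.pi)

theorem ae_mem_Icc_torusMeasure :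
    ∀ᵐ θ ∂torusMeasure V, θ ∈ Set.Icc (fun _ : V => -Real.pi) (fun _ => Real.pi) := by
  have hcoord (v : V) : ∀ᵐ θ ∂torusMeasure V, θ v ∈ Set.Ioc (-Real.pi) Real.pi :=
    Measure.tendsto_eval_ae_ae.eventually (ae_restrict_mem measurableSet_Ioc)
  filter_upwards [ae_all_iff.2 hcoord] with θ hθ
  exact ⟨fun v => (hθ v).1.le, fun v => (hθ v).2⟩

theorem integrable_torusMeasure_of_continuous {E : Type*} [NormedAddCommGroup E]
    [SecondCountableTopologyEither (V → ℝ) E] {g : (V → ℝ) → E} (hg : Continuous g) :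
    Integrable g (torusMeasure V) := by
  obtain ⟨K, hK⟩ := isCompact_Icc.exists_bound_of_continuousOn
    (hg.continuousOn (s := Set.Icc (fun _ : V => -Real.pi) fun _ => Real.pi))
  refine .of_bound hg.aestronglyMeasurable K ?_
  filter_upwards [ae_mem_Icc_torusMeasure] with θ hθ using hK θ hθ

theorem continuous_eval_torusPoint_div (P : MvPolynomial V ℂ) (m : V →₀ ℕ) :
    Continuous fun θ => eval (torusPoint θ) P / ∏ v, torusPoint θ v ^ m v := by
  refine ((MvPolynomial.continuous_eval P).comp continuous_torusPoint).div
    (continuous_finsetProd _ fun v _ => ?_)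
    fun θ => Finset.prod_ne_zero_iff.2 fun v _ => pow_ne_zero _ (torusPoint_ne_zero θ v)
  exact ((continuous_apply v).comp continuous_torusPoint).pow _

theorem integral_eval_torusPoint_div (P : MvPolynomial V ℂ) (m : V →₀ ℕ) (α : V → ℝ) :
    ∫ θ, eval (torusPoint (θ + α)) P / ∏ v, torusPoint (θ + α) v ^ m v ∂torusMeasure V =
      (2 * Real.pi) ^ Fintype.card V * coeff m P := by
  classical
  have hint (Q : MvPolynomial V ℂ) : Integrable (fun θ : V → ℝ =>
      eval (torusPoint (θ + α)) Q / ∏ v, torusPoint (θ + α) v ^ m v) (torusMeasure V) :=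
    integrable_torusMeasure_of_continuous
      ((continuous_eval_torusPoint_div Q m).comp (continuous_add_const α))
  induction P using MvPolynomial.induction_on' with
  | add p q hp hq =>
    simp_rw [map_add, add_div]
    rw [integral_add (hint p) (hint q), hp, hq, coeff_add, mul_add]
  | monomial k a =>
    have hchar (θ : V → ℝ) :
        eval (torusPoint (θ + α)) (monomial k a) / ∏ v, torusPoint (θ + α) v ^ m v =
          a * ∏ v, torusPoint (θ + α) v ^ (k v - m v : ℤ) := by
      simp_rw [zpow_sub₀ (torusPoint_ne_zero _ _), zpow_natCast]
      rw [eval_monomial, Finsupp.prod_fintype _ _ fun _ => pow_zero _, mul_div_assoc,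
        Finset.prod_div_distrib]
    simp_rw [hchar, torusPoint, Pi.add_apply]
    rw [integral_const_mul, integral_fintype_prod_eq_prod (𝕜 := ℂ) fun v (x : ℝ) =>
      Complex.exp ((x + α v : ℝ) * Complex.I) ^ (k v - m v : ℤ)]
    simp_rw [integral_exp_mul_I_zpow, sub_eq_zero, Nat.cast_inj]
    rw [coeff_monomial]
    split_ifs with h
    · simp [h, mul_comm]
    · obtain ⟨v, hv⟩ := DFunLike.ne_iff.1 h
      rw [Finset.prod_eq_zero (Finset.mem_univ v) (if_neg hv), mul_zero, mul_zero]

/-- A function of `z` and of the angles `θ` that is a Laurent polynomial in the `exp (i θ_v)`, with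
coefficients polynomial in `z`, whose numerator is stable for every `z` in the right half plane. -/
def StableTrigPoly (g : ℂ → (V → ℝ) → ℂ) : Prop :=
  ∃ (P : MvPolynomial V (Polynomial ℂ)) (m : V →₀ ℕ),
    (∀ z ∈ rightHalfPlane, Stable (map (Polynomial.evalRingHom z) P)) ∧
    ∀ z θ, g z θ =
      eval (torusPoint θ) (map (Polynomial.evalRingHom z) P) / ∏ v, torusPoint θ v ^ m v

namespace StableTrigPoly

theorem const {a : ℂ} (ha : a ≠ 0) : StableTrigPoly fun _ (_ : V → ℝ) => a :=
  ⟨C (Polynomial.C a), 0, fun z _ s _ => by simpa using ha, fun z θ => by simp⟩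

theorem mul {g h : ℂ → (V → ℝ) → ℂ} (hg : StableTrigPoly g) (hh : StableTrigPoly h) :
    StableTrigPoly fun z θ => g z θ * h z θ := by
  obtain ⟨P, m, hP, hg⟩ := hg
  obtain ⟨Q, k, hQ, hh⟩ := hh
  refine ⟨P * Q, m + k, fun z hz => ?_, fun z θ => ?_⟩
  · rw [map_mul]
    exact (hP z hz).mul (hQ z hz)
  · simp only [hg, hh, map_mul, Finsupp.add_apply, pow_add, Finset.prod_mul_distrib,
      div_mul_div_comm]

theorem prod {ι : Type*} (s : Finset ι) {g : ι → ℂ → (V → ℝ) → ℂ}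
    (hg : ∀ i, StableTrigPoly (g i)) : StableTrigPoly fun z θ => ∏ i ∈ s, g i z θ := by
  classical
  induction s using Finset.induction_on with
  | empty => simpa using const one_ne_zero
  | insert i s hi ih =>
    simp only [Finset.prod_insert hi]
    exact (hg i).mul ih

theorem pow {g : ℂ → (V → ℝ) → ℂ} (hg : StableTrigPoly g) (n : ℕ) :
    StableTrigPoly fun z θ => g z θ ^ n := by
  simpa using prod (Finset.range n) fun _ => hg

protected theorem continuous {g : ℂ → (V → ℝ) → ℂ} (hg : StableTrigPoly g) (z : ℂ) :
    Continuous (g z) := by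
  obtain ⟨P, m, -, hg⟩ := hg
  simpa only [← hg] using continuous_eval_torusPoint_div (map (Polynomial.evalRingHom z) P) m

theorem one_add_mul_div {c : ℝ} (hc : 0 ≤ c) (u v : V) :
    StableTrigPoly fun _ (θ : V → ℝ) => 1 + c * (torusPoint θ u / torusPoint θ v) := by
  classical
  refine ⟨X v + C (Polynomial.C (c : ℂ)) * X u, Finsupp.single v 1, fun z _ s hs h => ?_,
    fun z θ => ?_⟩
  · have hre : (s v).re + c * (s u).re = 0 := by simpa using congrArg Complex.re h
    linarith [mul_nonneg hc (hs u).le, hs v]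
  · have := torusPoint_ne_zero θ v
    simp [← Finsupp.prod_fintype, add_div, mul_div_assoc, this]

theorem one_add_mul_torusPoint {c : ℝ} (hc : 0 ≤ c) (v : V) :
    StableTrigPoly fun z (θ : V → ℝ) => 1 + c * z * torusPoint θ v := by
  refine ⟨1 + C (Polynomial.C (c : ℂ) * Polynomial.X) * X v, 0, fun z hz s hs h => ?_,
    fun z θ => by simp⟩
  have hz0 : z ≠ 0 := by rintro rfl; simp at hz
  have hinv : z⁻¹ + c * s v = 0 := by
    have h' : 1 + c * z * s v = 0 := by simpa using h
    field_simp
    linear_combination h'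
  have hre : (z⁻¹).re + c * (s v).re = 0 := by simpa using congrArg Complex.re hinv
  have hzinv : 0 < (z⁻¹).re := Complex.inv_re z ▸ div_pos hz (Complex.normSq_pos.2 hz0)
  linarith [mul_nonneg hc (hs v).le]

theorem one_add_mul_inv_torusPoint {c : ℝ} (hc : 0 ≤ c) (v : V) :
    StableTrigPoly fun z (θ : V → ℝ) => 1 + c * z * (torusPoint θ v)⁻¹ := by
  classical
  refine ⟨X v + C (Polynomial.C (c : ℂ) * Polynomial.X), Finsupp.single v 1,
    fun z hz s hs h => ?_, fun z θ => ?_⟩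
  · have hre : (s v).re + c * z.re = 0 := by simpa using congrArg Complex.re h
    linarith [mul_nonneg hc (le_of_lt hz), hs v]
  · have := torusPoint_ne_zero θ v
    simp [← Finsupp.prod_fintype, add_div, this, div_eq_mul_inv (_ * _)]

theorem exists_polynomial_integral {g : ℂ → (V → ℝ) → ℂ} (hg : StableTrigPoly g) :
    ∃ p : Polynomial ℂ, (∀ z α, ∫ θ, g z (θ + α) ∂torusMeasure V = p.eval z) ∧
      ZeroFreeOrZero (fun z => p.eval z) rightHalfPlane := by
  obtain ⟨P, m, hP, hg⟩ := hg
  refine ⟨Polynomial.C ((2 * Real.pi : ℂ) ^ Fintype.card V) * coeff m P, fun z α => ?_, ?_⟩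
  · simp_rw [hg, integral_eval_torusPoint_div, coeff_map, Polynomial.eval_mul, Polynomial.eval_C,
      Polynomial.coe_evalRingHom]
  · simpa [ZeroFreeOrZero, Real.pi_ne_zero] using zeroFreeOrZero_eval_coeff hP m

end StableTrigPoly

end ConstantTerm

section TrigLimit

variable {V : Type*} [Fintype V]

/-- A limit of stable trigonometric polynomials, continuous in `z` (the approximants converge along
`n → ∞` and `w → z` jointly) and bounded uniformly in the angles, so that it may be taken under the
integral over the torus. -/
def StableTrigLimit (g : ℂ → (V → ℝ) → ℂ) : Prop :=
  ∃ F : ℕ → ℂ → (V → ℝ) → ℂ, (∀ n, StableTrigPoly (F n)) ∧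
    (∀ z θ, Tendsto (fun p : ℕ × ℂ => F p.1 p.2 θ) (atTop ×ˢ 𝓝 z) (𝓝 (g z θ))) ∧
    ∀ z, ∃ K, ∀ᶠ p in atTop ×ˢ 𝓝 z, ∀ θ, ‖F p.1 p.2 θ‖ ≤ K

namespace StableTrigLimit

theorem const {a : ℂ} (ha : a ≠ 0) : StableTrigLimit fun _ (_ : V → ℝ) => a :=
  ⟨fun _ _ _ => a, fun _ => .const ha, fun _ _ => tendsto_const_nhds,
    fun _ => ⟨‖a‖, .of_forall fun _ _ => le_rfl⟩⟩

theorem mul {g h : ℂ → (V → ℝ) → ℂ} (hg : StableTrigLimit g) (hh : StableTrigLimit h) :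
    StableTrigLimit fun z θ => g z θ * h z θ := by
  obtain ⟨F, hF, hFg, hFb⟩ := hg
  obtain ⟨H, hH, hHh, hHb⟩ := hh
  refine ⟨fun n z θ => F n z θ * H n z θ, fun n => (hF n).mul (hH n),
    fun z θ => (hFg z θ).mul (hHh z θ), fun z => ?_⟩
  obtain ⟨K, hK⟩ := hFb z
  obtain ⟨L, hL⟩ := hHb z
  refine ⟨K * L, ?_⟩
  filter_upwards [hK, hL] with p hp hp' θ
  exact norm_mul_le_of_le (hp θ) (hp' θ)

theorem prod {ι : Type*} (s : Finset ι) {g : ι → ℂ → (V → ℝ) → ℂ}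
    (hg : ∀ i, StableTrigLimit (g i)) : StableTrigLimit fun z θ => ∏ i ∈ s, g i z θ := by
  classical
  induction s using Finset.induction_on with
  | empty => simpa using const one_ne_zero
  | insert i s hi ih =>
    simp only [Finset.prod_insert hi]
    exact (hg i).mul ih

theorem exists_polynomial_tendsto_integral {g : ℂ → (V → ℝ) → ℂ} (hg : StableTrigLimit g) :
    ∃ p : ℕ → Polynomial ℂ, (∀ n, ZeroFreeOrZero (fun z => (p n).eval z) rightHalfPlane) ∧
      ∀ z α, Tendsto (fun x : ℕ × ℂ => (p x.1).eval x.2) (atTop ×ˢ 𝓝 z)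
        (𝓝 (∫ θ, g z (θ + α) ∂torusMeasure V)) := by
  obtain ⟨F, hF, hFg, hFb⟩ := hg
  choose p hp hp0 using fun n => (hF n).exists_polynomial_integral
  refine ⟨p, hp0, fun z α => ?_⟩
  obtain ⟨K, hK⟩ := hFb z
  simp_rw [← hp _ _ α]
  refine tendsto_integral_filter_of_dominated_convergence (fun _ => K)
    (.of_forall fun x => ?_) ?_ (integrable_const K) (.of_forall fun θ => hFg z (θ + α))
  · exact (((hF x.1).continuous x.2).comp (continuous_add_const α)).aestronglyMeasurable
  · filter_upwards [hK] with x hx using .of_forall fun θ => hx (θ + α)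

theorem zeroFreeOrZero_integral {g : ℂ → (V → ℝ) → ℂ} (hg : StableTrigLimit g) :
    ZeroFreeOrZero (fun z => ∫ θ, g z θ ∂torusMeasure V) rightHalfPlane := by
  obtain ⟨p, hp0, hp⟩ := hg.exists_polynomial_tendsto_integral
  have hlim : TendstoLocallyUniformlyOn (fun n z => (p n).eval z)
      (fun z => ∫ θ, g z θ ∂torusMeasure V) atTop rightHalfPlane :=
    tendstoLocallyUniformlyOn_of_tendsto_prod isOpen_rightHalfPlane fun z _ => by simpa using hp z 0
  exact .of_tendstoLocallyUniformlyOn isOpen_rightHalfPlane isPreconnected_rightHalfPlane hlim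
    (.of_forall fun n => (p n).differentiable.differentiableOn) (.of_forall hp0)

theorem integral_add_const {g : ℂ → (V → ℝ) → ℂ} (hg : StableTrigLimit g) (z : ℂ) (α : V → ℝ) :
    ∫ θ, g z (θ + α) ∂torusMeasure V = ∫ θ, g z θ ∂torusMeasure V := by
  obtain ⟨p, -, hp⟩ := hg.exists_polynomial_tendsto_integral
  exact tendsto_nhds_unique (hp z α) (by simpa using hp z 0)

theorem integral_ne_zero {g : ℂ → (V → ℝ) → ℂ} (hg : StableTrigLimit g) {w z : ℂ}
    (hw : w ∈ rightHalfPlane) (hwg : ∫ θ, g w θ ∂torusMeasure V ≠ 0) (hz : z ∈ rightHalfPlane) :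
    ∫ θ, g z θ ∂torusMeasure V ≠ 0 :=
  (hg.zeroFreeOrZero_integral.resolve_right fun h => hwg (h w hw)) z hz

theorem re_eq_zero_of_integral_eq_zero {g : ℂ → (V → ℝ) → ℂ} (hg : StableTrigLimit g)
    {α : V → ℝ} (hneg : ∀ z θ, g (-z) θ = g z (θ + α)) {w : ℂ} (hw : w ∈ rightHalfPlane)
    (hwg : ∫ θ, g w θ ∂torusMeasure V ≠ 0) {z : ℂ} (hz : ∫ θ, g z θ ∂torusMeasure V = 0) :
    z.re = 0 := by
  have hneg_integral : ∫ θ, g (-z) θ ∂torusMeasure V = 0 := by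
    simp_rw [hneg, hg.integral_add_const, hz]
  by_contra hre
  rcases lt_or_gt_of_ne hre with h | h
  · exact hg.integral_ne_zero hw hwg (by simpa using h) hneg_integral
  · exact hg.integral_ne_zero hw hwg h hz

end StableTrigLimit

end TrigLimit

section TripleProduct

section Field

variable {K : Type*} [Field K]

/-- The finite `q`-Pochhammer symbol `(q; q)_n`. -/
def qPochhammer (q : K) (n : ℕ) : K :=
  ∏ i ∈ Finset.range n, (1 - q ^ (i + 1))

theorem qPochhammer_succ (q : K) (n : ℕ) :
    qPochhammer q (n + 1) = qPochhammer q n * (1 - q ^ (n + 1)) :=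
  Finset.prod_range_succ ..

/-- The reciprocal `1 / (q; q)_m`, extended by zero to negative `m` as for `1 / m!`. -/
def qPochhammerInv (q : K) (m : ℤ) : K :=
  if m < 0 then 0 else (qPochhammer q m.toNat)⁻¹

theorem qPochhammerInv_natCast (q : K) (m : ℕ) : qPochhammerInv q m = (qPochhammer q m)⁻¹ := by
  simp [qPochhammerInv]

theorem qPochhammerInv_of_neg (q : K) {m : ℤ} (hm : m < 0) : qPochhammerInv q m = 0 :=
  if_pos hm

theorem qPochhammerInv_sub_one {q : K} (hq : ∀ i : ℕ, q ^ (i + 1) ≠ 1) (m : ℤ) :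
    qPochhammerInv q (m - 1) = (1 - q ^ m) * qPochhammerInv q m := by
  rcases lt_or_ge m 0 with hm | hm
  · rw [qPochhammerInv_of_neg q hm, qPochhammerInv_of_neg q (by lia), mul_zero]
  · obtain ⟨k, rfl⟩ := Int.eq_ofNat_of_zero_le hm
    cases k with
    | zero => simp [qPochhammerInv]
    | succ k =>
      have hk : 1 - q ^ (k + 1) ≠ 0 := sub_ne_zero.2 (hq k).symm
      rw [Nat.cast_succ, add_sub_cancel_right, ← Nat.cast_succ, qPochhammerInv_natCast,
        qPochhammerInv_natCast, qPochhammer_succ, zpow_natCast, mul_inv_rev,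
        mul_inv_cancel_left₀ hk]

/-- The Gaussian binomial coefficient `[2n choose n + k]` in base `q`. -/
def centralQBinomial (q : K) (n : ℕ) (k : ℤ) : K :=
  qPochhammer q (2 * n) * (qPochhammerInv q (n + k) * qPochhammerInv q (n - k))

theorem centralQBinomial_zero (q : K) (k : ℤ) :
    centralQBinomial q 0 k = if k = 0 then 1 else 0 := by
  rcases lt_trichotomy k 0 with hk | rfl | hk
  · simp [centralQBinomial, qPochhammerInv_of_neg q hk, hk.ne]
  · simp [centralQBinomial, qPochhammerInv, qPochhammer]
  · simp [centralQBinomial, qPochhammerInv_of_neg q (neg_neg_of_pos hk), hk.ne']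

theorem centralQBinomial_succ {q : K} (hq0 : q ≠ 0) (hq : ∀ i : ℕ, (q ^ 2) ^ (i + 1) ≠ 1) (n : ℕ)
    (k : ℤ) :
    centralQBinomial (q ^ 2) (n + 1) k * q ^ (k ^ 2) =
      (1 + q ^ (2 * n + 1) * q ^ (2 * n + 1)) * (centralQBinomial (q ^ 2) n k * q ^ (k ^ 2)) +
      q ^ (2 * n + 1) * (centralQBinomial (q ^ 2) n (k - 1) * q ^ ((k - 1) ^ 2)) +
      q ^ (2 * n + 1) * (centralQBinomial (q ^ 2) n (k + 1) * q ^ ((k + 1) ^ 2)) := by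
  have hr (m : ℤ) : qPochhammerInv (q ^ 2) m =
      (1 - q ^ (m + 1) * q ^ (m + 1)) * qPochhammerInv (q ^ 2) (m + 1) := by
    rw [← mul_zpow, ← sq, ← qPochhammerInv_sub_one hq, add_sub_cancel_right]
  have hκ : q ^ k ≠ 0 := zpow_ne_zero k hq0
  have hpred : q ^ ((k - 1) ^ 2) = q ^ (k ^ 2) * ((q ^ k)⁻¹ * (q ^ k)⁻¹ * q) := by
    rw [← zpow_neg, ← zpow_add₀ hq0, ← zpow_add_one₀ hq0, ← zpow_add₀ hq0]
    ring_nf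
  have hsucc : q ^ ((k + 1) ^ 2) = q ^ (k ^ 2) * (q ^ k * q ^ k * q) := by
    rw [← zpow_add₀ hq0, ← zpow_add_one₀ hq0, ← zpow_add₀ hq0]
    ring_nf
  have h₁ : (n + (k - 1) + 1 : ℤ) = n + k := by ring
  have h₂ : (n - (k + 1) + 1 : ℤ) = n - k := by ring
  have h₃ : (n - (k - 1) : ℤ) = n - k + 1 := by ring
  have h₄ : ((n + 1 : ℕ) + k : ℤ) = n + k + 1 := by push_cast; ring
  have h₅ : ((n + 1 : ℕ) - k : ℤ) = n - k + 1 := by push_cast; ring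
  simp only [centralQBinomial, mul_add_one, qPochhammer_succ, hpred, hsucc, h₃, h₄, h₅, ← add_assoc,
    hr (n + (k - 1)), hr (n - (k + 1)), h₁, h₂, hr (n + k), hr (n - k)]
  -- All reciprocals are now those at `n ± k + 1`, leaving an identity in `q ^ n` and `κ = q ^ k`.
  simp only [zpow_add₀ hq0, zpow_sub₀ hq0, zpow_natCast, zpow_one]
  generalize q ^ k = κ at hκ ⊢
  field_simp
  ring

/-- The partial product `∏_{j < n} (1 + q^(2j+1) x) (1 + q^(2j+1) x⁻¹)` of the product side of the
Jacobi triple product identity. -/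
def tripleProduct (q x : K) (n : ℕ) : K :=
  ∏ j ∈ Finset.range n, (1 + q ^ (2 * j + 1) * x) * (1 + q ^ (2 * j + 1) * x⁻¹)

variable [TopologicalSpace K] [IsTopologicalRing K]

theorem hasSum_centralQBinomial {q : K} (hq0 : q ≠ 0) (hq : ∀ i : ℕ, (q ^ 2) ^ (i + 1) ≠ 1) {x : K}
    (hx : x ≠ 0) (n : ℕ) :
    HasSum (fun k : ℤ => centralQBinomial (q ^ 2) n k * q ^ (k ^ 2) * x ^ k)
      (tripleProduct q x n) := by
  induction n with
  | zero =>
    convert! hasSum_ite_eq (0 : ℤ) (1 : K) using 1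
    funext k
    split_ifs with hk <;> simp [centralQBinomial_zero, hk]
  | succ n ih =>
    have hshift_pred := (Equiv.subRight (1 : ℤ)).hasSum_iff.2 ih
    have hshift_succ := (Equiv.addRight (1 : ℤ)).hasSum_iff.2 ih
    convert! ((ih.mul_left (1 + q ^ (2 * n + 1) * q ^ (2 * n + 1))).add
      (hshift_pred.mul_left (q ^ (2 * n + 1) * x))).add
      (hshift_succ.mul_left (q ^ (2 * n + 1) * x⁻¹)) using 1
    · funext k
      simp only [centralQBinomial_succ hq0 hq n k, Function.comp, Equiv.subRight_apply,
        Equiv.coe_addRight, zpow_sub₀ hx, zpow_add₀ hx, zpow_one]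
      field_simp
    · rw [tripleProduct, Finset.prod_range_succ, ← tripleProduct]
      field_simp
      ring

end Field

variable {q : ℂ}

theorem tendsto_qPochhammer (hq : ‖q‖ < 1) :
    Tendsto (qPochhammer q) atTop (𝓝 (∏' i : ℕ, (1 - q ^ (i + 1)))) :=
  (ModularForm.multipliable_one_sub_pow hq).tendsto_prod_tprod_nat

theorem pow_succ_ne_one (hq : ‖q‖ < 1) (i : ℕ) : q ^ (i + 1) ≠ 1 := fun h =>
  (pow_lt_one₀ (norm_nonneg q) hq i.succ_ne_zero).ne (by rw [← norm_pow, h, norm_one])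

theorem tprod_one_sub_pow_ne_zero (hq : ‖q‖ < 1) : ∏' i : ℕ, (1 - q ^ (i + 1)) ≠ 0 := by
  have hsum : Summable fun i : ℕ => ‖-q ^ (i + 1)‖ := by
    simpa only [norm_neg, norm_pow] using
      (summable_nat_add_iff 1).2 (summable_geometric_of_lt_one (norm_nonneg q) hq)
  simp only [sub_eq_add_neg]
  refine tprod_one_add_ne_zero_of_summable (fun i => ?_) hsum
  rw [← sub_eq_add_neg]
  exact sub_ne_zero.2 (pow_succ_ne_one hq i).symm

theorem tendsto_qPochhammerInv (hq : ‖q‖ < 1) :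
    Tendsto (qPochhammerInv q) atTop (𝓝 (∏' i : ℕ, (1 - q ^ (i + 1)))⁻¹) := by
  rw [← Nat.map_cast_int_atTop, tendsto_map'_iff]
  exact ((tendsto_qPochhammer hq).inv₀ (tprod_one_sub_pow_ne_zero hq)).congr fun m =>
    (qPochhammerInv_natCast q m).symm

theorem exists_norm_qPochhammerInv_le (hq : ‖q‖ < 1) : ∃ C, ∀ m, ‖qPochhammerInv q m‖ ≤ C := by
  obtain ⟨C, hC⟩ :=
    ((tendsto_qPochhammer hq).inv₀ (tprod_one_sub_pow_ne_zero hq)).norm.bddAbove_range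
  have hC (m : ℕ) : ‖(qPochhammer q m)⁻¹‖ ≤ C := hC (Set.mem_range_self m)
  refine ⟨C, fun m => ?_⟩
  unfold qPochhammerInv
  split_ifs
  · exact norm_zero.trans_le ((norm_nonneg _).trans (hC 0))
  · exact hC _

theorem exists_norm_centralQBinomial_le (hq : ‖q‖ < 1) :
    ∃ C, ∀ n k, ‖centralQBinomial q n k‖ ≤ C := by
  obtain ⟨A, hA⟩ := (tendsto_qPochhammer hq).norm.bddAbove_range
  obtain ⟨B, hB⟩ := exists_norm_qPochhammerInv_le hq
  exact ⟨A * (B * B), fun n k => norm_mul_le_of_le (hA (Set.mem_range_self _))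
    (norm_mul_le_of_le (hB _) (hB _))⟩

theorem tendsto_centralQBinomial (hq : ‖q‖ < 1) (k : ℤ) :
    Tendsto (fun n => centralQBinomial q n k) atTop (𝓝 (∏' i : ℕ, (1 - q ^ (i + 1)))⁻¹) := by
  have hcast : Tendsto (fun n : ℕ => (n : ℤ)) atTop atTop := tendsto_natCast_atTop_atTop
  have hinv (j : ℤ) : Tendsto (fun n : ℕ => qPochhammerInv q (n + j)) atTop _ :=
    (tendsto_qPochhammerInv hq).comp (tendsto_atTop_add_const_right _ j hcast)
  have hmain : Tendsto (fun n : ℕ => qPochhammer q (2 * n)) atTop _ :=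
    (tendsto_qPochhammer hq).comp (tendsto_id.const_mul_atTop' two_pos)
  simpa only [centralQBinomial, ← sub_eq_add_neg,
    mul_inv_cancel_left₀ (tprod_one_sub_pow_ne_zero hq)] using
    hmain.mul ((hinv k).mul (hinv (-k)))

theorem norm_exp_pi_mul_I_lt_one {τ : ℂ} (hτ : 0 < τ.im) :
    ‖Complex.exp (Real.pi * Complex.I * τ)‖ < 1 := by
  simpa [Complex.norm_exp] using mul_pos Real.pi_pos hτ

theorem jacobiTheta₂_term_eq_zpow (k : ℤ) (z τ : ℂ) :
    jacobiTheta₂_term k z τ = Complex.exp (Real.pi * Complex.I * τ) ^ (k ^ 2) *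
      Complex.exp (2 * Real.pi * Complex.I * z) ^ k := by
  rw [jacobiTheta₂_term, ← Complex.exp_int_mul, ← Complex.exp_int_mul, ← Complex.exp_add]
  push_cast
  ring_nf

theorem tendsto_tripleProduct {τ : ℂ} (hτ : 0 < τ.im) (z : ℂ) :
    Tendsto (tripleProduct (Complex.exp (Real.pi * Complex.I * τ))
      (Complex.exp (2 * Real.pi * Complex.I * z))) atTop
      (𝓝 ((∏' i : ℕ, (1 - (Complex.exp (Real.pi * Complex.I * τ) ^ 2) ^ (i + 1)))⁻¹ *
        jacobiTheta₂ z τ)) := by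
  set q := Complex.exp (Real.pi * Complex.I * τ)
  have hq2 : ‖q ^ 2‖ < 1 := by
    rw [norm_pow]
    exact pow_lt_one₀ (norm_nonneg q) (norm_exp_pi_mul_I_lt_one hτ) two_ne_zero
  obtain ⟨C, hC⟩ := exists_norm_centralQBinomial_le hq2
  have hbound : Summable fun k : ℤ => C * ‖jacobiTheta₂_term k z τ‖ :=
    ((summable_jacobiTheta₂_term_iff z τ).2 hτ).norm.mul_left C
  have hsum (n : ℕ) := hasSum_centralQBinomial (Complex.exp_ne_zero (Real.pi * Complex.I * τ))
    (pow_succ_ne_one hq2) (Complex.exp_ne_zero (2 * Real.pi * Complex.I * z)) n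
  simp_rw [mul_assoc (centralQBinomial _ _ _), ← jacobiTheta₂_term_eq_zpow] at hsum
  rw [jacobiTheta₂, ← tsum_mul_left]
  refine (tendsto_tsum_of_dominated_convergence hbound
    (fun k => (tendsto_centralQBinomial hq2 k).mul_const _)
    (.of_forall fun n k => norm_mul_le_of_le (hC n k) le_rfl)).congr fun n => (hsum n).tsum_eq

theorem norm_tripleProduct_le {q : ℝ} (hq : 0 ≤ q) {x : ℂ} (hx : ‖x‖ = 1) (n : ℕ) :
    ‖tripleProduct (q : ℂ) x n‖ ≤ ‖tripleProduct (q : ℂ) 1 n‖ := by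
  have hone {y : ℂ} (hy : ‖y‖ = 1) (j : ℕ) : ‖1 + (q : ℂ) ^ j * y‖ ≤ ‖1 + (q : ℂ) ^ j‖ := by
    have hqj : ‖1 + (q : ℂ) ^ j‖ = 1 + q ^ j := by
      exact_mod_cast Complex.norm_of_nonneg (by positivity : 0 ≤ 1 + q ^ j)
    simpa [hy, hqj, abs_of_nonneg hq] using norm_add_le 1 ((q : ℂ) ^ j * y)
  simp only [tripleProduct, norm_prod, norm_mul, inv_one, mul_one]
  gcongr
  · exact hone hx _
  · exact hone (by rw [norm_inv, hx, inv_one]) _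

end TripleProduct

section EdgeWeight

theorem hasSum_edgeWeight {J : ℝ} (hJ : 0 < J) (θ : ℝ) :
    HasSum (fun m : ℤ => Real.exp (-(J / 2) * (θ + 2 * Real.pi * m) ^ 2))
      (HurwitzZeta.evenKernel (θ / (2 * Real.pi) : ℝ) (2 * Real.pi * J)) := by
  have := Real.pi_pos
  convert! HurwitzZeta.hasSum_int_evenKernel (θ / (2 * Real.pi))
    (t := 2 * Real.pi * J) (by positivity) using 3 with m
  field_simp
  ring

theorem edgeWeight_eq_evenKernel {J : ℝ} (hJ : 0 < J) (θ : ℝ) :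
    edgeWeight J θ = HurwitzZeta.evenKernel (θ / (2 * Real.pi) : ℝ) (2 * Real.pi * J) := by
  rw [edgeWeight, if_neg hJ.ne', (hasSum_edgeWeight hJ θ).tsum_eq]

theorem edgeWeight_pos {J : ℝ} (hJ : 0 ≤ J) (θ : ℝ) : 0 < edgeWeight J θ := by
  rcases hJ.eq_or_lt with rfl | hJ
  · simp [edgeWeight]
  · rw [edgeWeight, if_neg hJ.ne']
    exact (hasSum_edgeWeight hJ θ).summable.tsum_pos (fun m => (Real.exp_pos _).le) 0
      (Real.exp_pos _)

/-- Poisson summation for the periodized Gaussian. -/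
theorem edgeWeight_eq_jacobiTheta₂ {J : ℝ} (hJ : 0 < J) (θ : ℝ) :
    (edgeWeight J θ : ℂ) = (1 / (2 * Real.pi * J) ^ (1 / 2 : ℝ) : ℝ) *
      jacobiTheta₂ (θ / (2 * Real.pi) : ℝ) (Complex.I * (1 / (2 * Real.pi * J) : ℝ)) := by
  rw [edgeWeight_eq_evenKernel hJ, HurwitzZeta.evenKernel_functional_equation, Complex.ofReal_mul,
    HurwitzZeta.cosKernel_def]

theorem im_I_mul_ofReal_pos {t : ℝ} (ht : 0 < t) : 0 < (Complex.I * t).im := by simpa using ht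

theorem continuous_edgeWeight {J : ℝ} (hJ : 0 ≤ J) : Continuous (edgeWeight J) := by
  rcases hJ.eq_or_lt with rfl | hJ
  · have hone : edgeWeight 0 = fun _ => 1 := funext fun θ => if_pos rfl
    exact hone ▸ continuous_const
  · have hτ := im_I_mul_ofReal_pos (t := 1 / (2 * Real.pi * J)) (by have := Real.pi_pos; positivity)
    have htheta : Continuous fun w => jacobiTheta₂ w (Complex.I * (1 / (2 * Real.pi * J) : ℝ)) :=
      continuous_iff_continuousAt.2 fun w => (differentiableAt_jacobiTheta₂_fst w hτ).continuousAt
    refine Complex.isometry_ofReal.isEmbedding.continuous_iff.2 ?_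
    simp only [Function.comp_def, edgeWeight_eq_jacobiTheta₂ hJ]
    fun_prop

theorem exp_pi_mul_I_mul_I_mul (t : ℝ) :
    Complex.exp (Real.pi * Complex.I * (Complex.I * t)) = Real.exp (-Real.pi * t) := by
  rw [Complex.ofReal_exp]
  congr 1
  push_cast
  linear_combination Real.pi * t * Complex.I_mul_I

theorem exists_tendsto_tripleProduct {t : ℝ} (ht : 0 < t) :
    ∃ L : ℂ, L ≠ 0 ∧ ∀ x : ℝ,
      Tendsto (tripleProduct (Real.exp (-Real.pi * t) : ℂ) (Complex.exp (x * Complex.I))) atTop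
        (𝓝 (L * jacobiTheta₂ (x / (2 * Real.pi) : ℝ) (Complex.I * t))) := by
  have hτ := im_I_mul_ofReal_pos ht
  have hq : ‖Complex.exp (Real.pi * Complex.I * (Complex.I * t)) ^ 2‖ < 1 := by
    rw [norm_pow]
    exact pow_lt_one₀ (norm_nonneg _) (norm_exp_pi_mul_I_lt_one hτ) two_ne_zero
  refine ⟨_, inv_ne_zero (tprod_one_sub_pow_ne_zero hq), fun x => ?_⟩
  have hx : 2 * Real.pi * Complex.I * (x / (2 * Real.pi) : ℝ) = x * Complex.I := by
    have hπ : (Real.pi : ℂ) ≠ 0 := Complex.ofReal_ne_zero.2 Real.pi_ne_zero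
    push_cast
    field_simp
  simpa only [hx, ← Complex.ofReal_exp, exp_pi_mul_I_mul_I_mul] using
    tendsto_tripleProduct hτ (x / (2 * Real.pi) : ℝ)

theorem exists_norm_tripleProduct_le {t : ℝ} (ht : 0 < t) :
    ∃ K, ∀ n x, ‖x‖ = 1 → ‖tripleProduct (Real.exp (-Real.pi * t) : ℂ) x n‖ ≤ K := by
  obtain ⟨L, -, hL⟩ := exists_tendsto_tripleProduct ht
  obtain ⟨K, hK⟩ := (hL 0).norm.bddAbove_range
  refine ⟨K, fun n x hx => (norm_tripleProduct_le (Real.exp_nonneg _) hx n).trans ?_⟩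
  simpa using hK (Set.mem_range_self n)

variable {V : Type*}

theorem torusPoint_div_torusPoint (θ : V → ℝ) (u v : V) :
    torusPoint θ u / torusPoint θ v = Complex.exp ((θ u - θ v : ℝ) * Complex.I) := by
  rw [torusPoint, torusPoint, ← Complex.exp_sub]
  push_cast
  ring_nf

variable [Fintype V]

theorem StableTrigPoly.tripleProduct_div {q : ℝ} (hq : 0 ≤ q) (u v : V) (n : ℕ) :
    StableTrigPoly fun _ (θ : V → ℝ) =>
      tripleProduct (q : ℂ) (torusPoint θ u / torusPoint θ v) n := by
  refine .prod _ fun j => ?_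
  have hqj : 0 ≤ q ^ (2 * j + 1) := by positivity
  simpa using (one_add_mul_div hqj u v).mul (one_add_mul_div hqj v u)

theorem StableTrigLimit.jacobiTheta₂_sub {t : ℝ} (ht : 0 < t) (u v : V) :
    StableTrigLimit fun _ (θ : V → ℝ) =>
      jacobiTheta₂ ((θ u - θ v) / (2 * Real.pi) : ℝ) (Complex.I * t) := by
  obtain ⟨L, hL0, hL⟩ := exists_tendsto_tripleProduct ht
  obtain ⟨K, hK⟩ := exists_norm_tripleProduct_le ht
  have hlim : StableTrigLimit fun _ (θ : V → ℝ) =>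
      L * jacobiTheta₂ ((θ u - θ v) / (2 * Real.pi) : ℝ) (Complex.I * t) := by
    refine ⟨_, StableTrigPoly.tripleProduct_div (Real.exp_nonneg (-Real.pi * t)) u v, fun z θ => ?_,
      fun z => ⟨K, .of_forall fun p θ => hK p.1 _ ?_⟩⟩
    · rw [torusPoint_div_torusPoint]
      exact (hL _).comp tendsto_fst
    · rw [torusPoint_div_torusPoint, Complex.norm_exp_ofReal_mul_I]
  simpa [inv_mul_cancel_left₀ hL0] using (const (inv_ne_zero hL0)).mul hlim

theorem StableTrigLimit.edgeWeight_sub {J : ℝ} (hJ : 0 ≤ J) (u v : V) :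
    StableTrigLimit fun _ (θ : V → ℝ) => (edgeWeight J (θ u - θ v) : ℂ) := by
  rcases hJ.eq_or_lt with rfl | hJ
  · simpa [edgeWeight] using const (V := V) one_ne_zero
  · have : 0 < 2 * Real.pi * J := by have := Real.pi_pos; positivity
    have hconst : ((1 / (2 * Real.pi * J) ^ (1 / 2 : ℝ) : ℝ) : ℂ) ≠ 0 :=
      Complex.ofReal_ne_zero.2 (by positivity)
    simp only [edgeWeight_eq_jacobiTheta₂ hJ]
    exact (const hconst).mul (.jacobiTheta₂_sub (by positivity) u v)

end EdgeWeight

section Exponential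

theorem tendsto_one_add_div_pow {ι : Type*} {l : Filter ι} {n : ι → ℕ} {w : ι → ℂ} {w₀ : ℂ}
    (hn : Tendsto n l atTop) (hw : Tendsto w l (𝓝 w₀)) :
    Tendsto (fun i => (1 + w i / n i) ^ n i) l (𝓝 (Complex.exp w₀)) := by
  have hdiv : Tendsto (fun i => w i / n i) l (𝓝 0) := by
    simpa [div_eq_mul_inv] using hw.mul ((tendsto_inv_atTop_nhds_zero_nat (𝕜 := ℂ)).comp hn)
  have hn0 : ∀ᶠ i in l, (n i : ℂ) ≠ 0 :=
    (hn.eventually_ne_atTop 0).mono fun i hi => Nat.cast_ne_zero.2 hi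
  have hmul : Tendsto (fun i => (n i : ℂ) • (w i / n i)) l (𝓝 w₀) :=
    hw.congr' (hn0.mono fun i hi => (mul_div_cancel₀ _ hi).symm)
  have hlog : Tendsto (fun i => n i * Complex.log (1 + w i / n i)) l (𝓝 w₀) := by
    simpa using (Complex.hasDerivAt_log Complex.one_mem_slitPlane).hasFDerivAt.hasFDerivWithinAt.lim
      hdiv (.of_forall fun _ => Set.mem_univ _) hmul
  refine ((Complex.continuous_exp.tendsto _).comp hlog).congr' ?_
  filter_upwards [hdiv.eventually_ne (neg_ne_zero.2 one_ne_zero).symm] with i hi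
  have hi : 1 + w i / n i ≠ 0 := fun h => hi (eq_neg_of_add_eq_zero_right h)
  rw [Function.comp, Complex.exp_nat_mul, Complex.exp_log hi]

theorem norm_one_add_div_pow_le (w : ℂ) (n : ℕ) : ‖(1 + w / n) ^ n‖ ≤ Real.exp ‖w‖ := by
  rcases n.eq_zero_or_pos with rfl | hn
  · simp
  calc ‖(1 + w / n) ^ n‖ ≤ (1 + ‖w‖ / n) ^ n := by
        rw [norm_pow]
        gcongr
        simpa using norm_add_le 1 (w / n)
    _ ≤ Real.exp (‖w‖ / n) ^ n := by
        gcongr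
        rw [add_comm]
        exact Real.add_one_le_exp _
    _ = Real.exp ‖w‖ := by
        rw [← Real.exp_nat_mul, mul_div_cancel₀ _ (Nat.cast_ne_zero.2 hn.ne')]

variable {V : Type*} [Fintype V]

theorem StableTrigLimit.exp_mul {y : (V → ℝ) → ℂ} (hy : ∀ θ, ‖y θ‖ = 1)
    (hstable : ∀ c : ℝ, 0 ≤ c → StableTrigPoly fun z θ => 1 + c * z * y θ) {c : ℝ} (hc : 0 ≤ c) :
    StableTrigLimit fun z θ => Complex.exp (c * z * y θ) := by
  refine ⟨fun n z θ => (1 + c * z * y θ / n) ^ n, fun n => ?_, fun z θ => ?_, fun z => ?_⟩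
  · convert! (hstable (c / n) (by positivity)).pow n using 4
    push_cast
    ring
  · exact tendsto_one_add_div_pow tendsto_fst ((tendsto_snd.const_mul _).mul_const _)
  · refine ⟨Real.exp (c * (‖z‖ + 1)), ?_⟩
    have hnorm : ∀ᶠ w in 𝓝 z, ‖w‖ < ‖z‖ + 1 :=
      continuous_norm.continuousAt.eventually_lt_const (lt_add_one _)
    filter_upwards [tendsto_snd.eventually hnorm] with p hp θ
    refine (norm_one_add_div_pow_le _ _).trans (Real.exp_le_exp.2 ?_)
    rw [norm_mul, norm_mul, hy, mul_one, Complex.norm_of_nonneg hc]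
    gcongr

theorem StableTrigLimit.exp_mul_magnetization {lam : V → ℝ} (hlam : ∀ v, 0 ≤ lam v) :
    StableTrigLimit fun z θ => Complex.exp (z * magnetization lam θ) := by
  have hcos (θ : V → ℝ) (v : V) :
      (Real.cos (θ v) : ℂ) = (torusPoint θ v + (torusPoint θ v)⁻¹) / 2 := by
    rw [Complex.ofReal_cos, Complex.cos, torusPoint, ← Complex.exp_neg, neg_mul]
  have hsite (v : V) : StableTrigLimit fun z θ =>
      Complex.exp ((lam v / 2 : ℝ) * z * torusPoint θ v) *
        Complex.exp ((lam v / 2 : ℝ) * z * (torusPoint θ v)⁻¹) := by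
    have hc : 0 ≤ lam v / 2 := div_nonneg (hlam v) zero_le_two
    have hinv (θ : V → ℝ) : ‖(torusPoint θ v)⁻¹‖ = 1 := by
      rw [norm_inv, norm_torusPoint, inv_one]
    exact .mul (exp_mul (norm_torusPoint · v) (fun _ hc => .one_add_mul_torusPoint hc v) hc)
      (exp_mul hinv (fun _ hc => .one_add_mul_inv_torusPoint hc v) hc)
  convert! prod Finset.univ hsite using 3 with z θ
  simp_rw [← Complex.exp_add, ← Complex.exp_sum, magnetization, Complex.ofReal_sum, Finset.mul_sum,
    Complex.ofReal_mul, hcos]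
  congr! 2 with v
  push_cast
  ring

end Exponential

section GibbsMeasure

variable {V : Type*}

theorem exists_pairWeight_eq (e : Sym2 V) :
    ∃ u v, ∀ (J : ℝ) (θ : V → ℝ), pairWeight J θ e = edgeWeight J (θ u - θ v) :=
  e.ind fun u v => ⟨u, v, fun _ _ => rfl⟩

theorem magnetization_add_pi [Fintype V] (lam θ : V → ℝ) :
    magnetization lam (θ + fun _ => Real.pi) = -magnetization lam θ := by
  simp only [magnetization, Pi.add_apply, Real.cos_add_pi, mul_neg, Finset.sum_neg_distrib]

theorem continuous_magnetization [Fintype V] (lam : V → ℝ) : Continuous (magnetization lam) := by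
  unfold magnetization
  fun_prop

theorem abs_magnetization_le [Fintype V] (lam θ : V → ℝ) :
    |magnetization lam θ| ≤ ∑ v, |lam v| := by
  refine (Finset.abs_sum_le_sum_abs _ _).trans (Finset.sum_le_sum fun v _ => ?_)
  rw [abs_mul]
  exact mul_le_of_le_one_right (abs_nonneg _) (Real.abs_cos_le_one _)

variable (G : SimpleGraph V) [Fintype G.edgeSet] {J : G.edgeSet → ℝ}

theorem density_pos (hJ : ∀ e, 0 ≤ J e) (θ : V → ℝ) : 0 < density G J θ := by
  refine Finset.prod_pos fun e _ => ?_
  obtain ⟨u, v, huv⟩ := exists_pairWeight_eq e.1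
  exact huv _ _ ▸ edgeWeight_pos (hJ e) _

theorem continuous_density (hJ : ∀ e, 0 ≤ J e) : Continuous (density G J) := by
  refine continuous_finsetProd _ fun e _ => ?_
  obtain ⟨u, v, huv⟩ := exists_pairWeight_eq e.1
  simp_rw [huv]
  exact (continuous_edgeWeight (hJ e)).comp (by fun_prop)

theorem density_add_const (J : G.edgeSet → ℝ) (θ : V → ℝ) (a : ℝ) :
    density G J (θ + fun _ => a) = density G J θ := by
  refine Finset.prod_congr rfl fun e _ => ?_
  obtain ⟨u, v, huv⟩ := exists_pairWeight_eq e.1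
  simp only [huv, Pi.add_apply, add_sub_add_right_eq_sub]

variable [Fintype V]

theorem StableTrigLimit.density (hJ : ∀ e, 0 ≤ J e) :
    StableTrigLimit fun _ (θ : V → ℝ) => (density G J θ : ℂ) := by
  simp only [Villain.density, Complex.ofReal_prod]
  refine .prod _ fun e => ?_
  obtain ⟨u, v, huv⟩ := exists_pairWeight_eq e.1
  simpa only [huv] using StableTrigLimit.edgeWeight_sub (hJ e) u v

theorem isFiniteMeasure_unnormalizedMeasure (hJ : ∀ e, 0 ≤ J e) :
    IsFiniteMeasure (unnormalizedMeasure G J) :=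
  isFiniteMeasure_withDensity_ofReal
    (integrable_torusMeasure_of_continuous (continuous_density G hJ)).hasFiniteIntegral

theorem neZero_unnormalizedMeasure (hJ : ∀ e, 0 ≤ J e) : NeZero (unnormalizedMeasure G J) := by
  have hvolume : torusMeasure V Set.univ ≠ 0 := by
    simp [Measure.pi_univ, Real.pi_pos]
  refine ⟨fun h => hvolume ?_⟩
  rw [unnormalizedMeasure, withDensity_eq_zero_iff
    (continuous_density G hJ).measurable.ennreal_ofReal.aemeasurable] at h
  refine measure_mono_null (fun θ _ => ?_) h
  exact (ENNReal.ofReal_pos.2 (density_pos G hJ θ)).ne'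

theorem isProbabilityMeasure_gibbsMeasure (hJ : ∀ e, 0 ≤ J e) :
    IsProbabilityMeasure (gibbsMeasure G J) :=
  have := isFiniteMeasure_unnormalizedMeasure G hJ
  have := neZero_unnormalizedMeasure G hJ
  isProbabilityMeasureSMul

theorem integral_gibbsMeasure (hJ : ∀ e, 0 ≤ J e) (g : (V → ℝ) → ℂ) :
    ∫ θ, g θ ∂gibbsMeasure G J =
      ((unnormalizedMeasure G J).real Set.univ)⁻¹ •
        ∫ θ, density G J θ * g θ ∂torusMeasure V := by
  rw [gibbsMeasure, integral_smul_measure, ENNReal.toReal_inv, unnormalizedMeasure,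
    integral_withDensity_eq_integral_toReal_smul (continuous_density G hJ).measurable.ennreal_ofReal
      (.of_forall fun _ => ENNReal.ofReal_lt_top)]
  simp_rw [ENNReal.toReal_ofReal (density_pos G hJ _).le, Complex.real_smul]
  rfl

theorem integral_gibbsMeasure_eq_zero_iff (hJ : ∀ e, 0 ≤ J e) (g : (V → ℝ) → ℂ) :
    ∫ θ, g θ ∂gibbsMeasure G J = 0 ↔ ∫ θ, density G J θ * g θ ∂torusMeasure V = 0 := by
  have := isFiniteMeasure_unnormalizedMeasure G hJ
  have := neZero_unnormalizedMeasure G hJ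
  rw [integral_gibbsMeasure G hJ, smul_eq_zero_iff_right (inv_ne_zero measureReal_univ_ne_zero)]

theorem integrable_exp_magnetization (hJ : ∀ e, 0 ≤ J e) (lam : V → ℝ) (z : ℂ) :
    Integrable (fun θ => Complex.exp (z * magnetization lam θ)) (gibbsMeasure G J) := by
  have := isProbabilityMeasure_gibbsMeasure G hJ
  have hcont := continuous_magnetization lam
  refine .of_bound (Continuous.aestronglyMeasurable (by fun_prop))
    (Real.exp (‖z‖ * ∑ v, |lam v|)) (.of_forall fun θ => ?_)
  refine (Complex.norm_exp_le_exp_norm _).trans (Real.exp_le_exp.2 ?_)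
  rw [norm_mul, Complex.norm_real]
  exact mul_le_mul_of_nonneg_left (abs_magnetization_le lam θ) (norm_nonneg _)

theorem integral_exp_magnetizationLaw (J : G.edgeSet → ℝ) (lam : V → ℝ) (z : ℂ) :
    ∫ θ, Complex.exp (z * magnetization lam θ) ∂gibbsMeasure G J =
      ∫ x : ℝ, Complex.exp (z * x) ∂magnetizationLaw G J lam := by
  rw [magnetizationLaw, integral_map (continuous_magnetization lam).aemeasurable
    (Continuous.aestronglyMeasurable (by fun_prop))]

theorem integral_exp_ofReal_mul_magnetization_ne_zero (hJ : ∀ e, 0 ≤ J e) (lam : V → ℝ) (x : ℝ) :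
    ∫ θ, Complex.exp (x * magnetization lam θ) ∂gibbsMeasure G J ≠ 0 := by
  have := isProbabilityMeasure_gibbsMeasure G hJ
  have hint := integrable_exp_magnetization G hJ lam x
  simp_rw [← Complex.ofReal_mul, ← Complex.ofReal_exp] at hint ⊢
  rw [integral_complex_ofReal]
  exact Complex.ofReal_ne_zero.2 (integral_exp_pos hint.re).ne'

theorem re_eq_zero_of_integral_exp_magnetization_eq_zero (hJ : ∀ e, 0 ≤ J e) {lam : V → ℝ}
    (hlam : ∀ v, 0 ≤ lam v) {z : ℂ}
    (hz : ∫ θ, Complex.exp (z * magnetization lam θ) ∂gibbsMeasure G J = 0) : z.re = 0 := by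
  have hlimit := (StableTrigLimit.density G hJ).mul (StableTrigLimit.exp_mul_magnetization hlam)
  have hone := integral_exp_ofReal_mul_magnetization_ne_zero G hJ lam 1
  rw [Ne, integral_gibbsMeasure_eq_zero_iff G hJ] at hone
  rw [integral_gibbsMeasure_eq_zero_iff G hJ] at hz
  refine hlimit.re_eq_zero_of_integral_eq_zero (α := fun _ => Real.pi) (fun z θ => ?_)
    (by simp) hone hz
  rw [density_add_const, magnetization_add_pi, Complex.ofReal_neg, mul_neg, neg_mul]

end GibbsMeasure

end Villain

theorem mainTheorem3 {V : Type*} [Fintype V] (G : SimpleGraph V) [Fintype G.edgeSet]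
    (J : G.edgeSet → ℝ) (hJ : ∀ e, 0 ≤ J e) (lam : V → ℝ) (hlam : ∀ v, 0 ≤ lam v) :
    MeasureTheory.IsProbabilityMeasure (Villain.gibbsMeasure G J) ∧
    (∀ z : ℂ, MeasureTheory.Integrable
      (fun θ : V → ℝ => Complex.exp (z * (Villain.magnetization lam θ : ℂ)))
      (Villain.gibbsMeasure G J)) ∧
    (∀ z : ℂ, ∫ θ, Complex.exp (z * (Villain.magnetization lam θ : ℂ)) ∂(Villain.gibbsMeasure G J)
      = ∫ x : ℝ, Complex.exp (z * (x : ℂ)) ∂(Villain.magnetizationLaw G J lam)) ∧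
    ∀ z : ℂ,
      ∫ θ, Complex.exp (z * (Villain.magnetization lam θ : ℂ)) ∂(Villain.gibbsMeasure G J) = 0 →
        z.re = 0 :=
  ⟨Villain.isProbabilityMeasure_gibbsMeasure G hJ,
    Villain.integrable_exp_magnetization G hJ lam,
    Villain.integral_exp_magnetizationLaw G J lam,
    fun _ hz => Villain.re_eq_zero_of_integral_exp_magnetization_eq_zero G hJ hlam hz⟩
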